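/- Let $p\ge 0$, let $\beta=\sigma_{i_1}\sigma_{i_2}\cdots\sigma_{i_m}$ be a positive braid word on $p$ strands (a word, possibly empty, in the generators $\sigma_1,\dots,\sigma_{p-1}$, without inverses), let $K$ be the positive braid knot (or link) that is the closure of $\beta$, and let $D$ be its planar diagram given by closing up $\beta$. Choose any ordering of the $m$ crossings of $D$. For a resolution $\epsilon\in\{0,1\}^m$ of $D$ (for a positive crossing, the 0-resolution is the one that respects the orientation) let $M_\epsilon$ be the tensor product of one copy of $V=\mathbb{Z}1\oplus\mathbb{Z}X$ for each circle of $D_\epsilon$, let $C^i(D)=\bigoplus_{|\epsilon|=i}M_\epsilon$, and let $d^i:C^i(D)\to C^{i+1}(D)$ be the Khovanov differential: the sum, over the edges of the cube that change one crossing from its 0- to its 1-resolution, of the per-edge maps given by $m(1\otimes 1)=1$, $m(1\otimes X)=m(X\otimes 1)=X$, $m(X\otimes X)=0$ where two circles merge, by $\Delta(1)=1\otimes X+X\otimes 1$, $\Delta(X)=X\otimes X$ where a circle splits, and by the identity on the other circles, with the sign $(-1)^{f}$, $f$ being the number of 1-resolved crossings that precede the changed one. The Khovanov homology $\mathcal{H}^i(K)$,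 computed from $D$, is $\mathcal H^i(D)=H^{i+n_-}(C(D),d)$, where $n_-$ is the number of negative crossings of $D$ (here $n_-=0$). Then $$\mathcal{H}^1(K)=\mathcal{H}^1(D)=0 .$$ -/

import Mathlib

noncomputable section

/-- The combinatorial data of an oriented link diagram (an oriented planar-diagram code).
`C` is the set of crossings, `A` the set of arcs and `P` a set of marked points on the strands
(2-valent vertices, which subdivide the strands into arcs; they carry no topological information,
and allow for components without crossings).
Turn a crossing `c` so that both strands run upwards. Then `inL c`, `inR c` are the arcs that enter
it at the bottom left and bottom right, and `outL c`, `outR c` those that leave it at the top left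
and top right; `sign c` is `1` if the crossing is positive (the strand from `inL c` to `outR c`
passes over) and `-1` if it is negative (the strand from `inR c` to `outL c` passes over).
At a marked point `q`, the arc `src q` comes in and the arc `dst q` goes out. -/
structure LinkDiagram (C A P : Type) where
  sign : C → ℤˣ
  inL : C → A
  inR : C → A
  outL : C → A
  outR : C → A
  src : P → A
  dst : P → A
  /-- Every arc ends at exactly one place. -/
  ends : Function.Bijective (Sum.elim (Sum.elim inL inR) src)
  /-- Every arc starts at exactly one place. -/
  starts : Function.Bijective (Sum.elim (Sum.elim outL outR) dst)

/-- The two basis vectors `1` and `X` of the free `ℤ`-module `V`. -/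
inductive Gen : Type
  | one : Gen
  | X : Gen

instance : Finite Gen :=
  Finite.of_injective (fun g : Gen => (Gen.casesOn g true false : Bool)) (by
    intro a b h
    cases a <;> cases b <;> simp_all)

namespace Gen

/-- The structure constants of `m : V ⊗ V → V`: the coefficient of `z` in `m (x ⊗ y)`. -/
def mulCoeff : Gen → Gen → Gen → ℤ
  | one, one, one => 1
  | one, X, X => 1
  | X, one, X => 1
  | _, _, _ => 0

/-- The structure constants of `Δ : V → V ⊗ V`: the coefficient of `y ⊗ z` in `Δ x`. -/
def comulCoeff : Gen → Gen → Gen → ℤ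
  | one, one, X => 1
  | one, X, one => 1
  | X, X, X => 1
  | _, _, _ => 0

end Gen

namespace LinkDiagram

variable {C A P : Type} (D : LinkDiagram C A P)

/-- A total resolution is encoded by the set `ε` of the crossings that are 1-resolved.
`D.Oriented ε c` says that `c` is then resolved in the way that respects the orientation
(`inL` to `outL`, `inR` to `outR`): this is the 0-resolution of a positive crossing and
the 1-resolution of a negative one. -/
def Oriented (ε : Finset C) (c : C) : Prop := D.sign c = 1 ↔ c ∉ ε

/-- Two arcs are glued at one of their ends in the resolution `ε`. -/
inductive Glue (ε : Finset C) : A → A → Prop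
  | point (q : P) : Glue ε (D.src q) (D.dst q)
  | left (c : C) : D.Oriented ε c → Glue ε (D.inL c) (D.outL c)
  | right (c : C) : D.Oriented ε c → Glue ε (D.inR c) (D.outR c)
  | cap (c : C) : ¬ D.Oriented ε c → Glue ε (D.inL c) (D.inR c)
  | cup (c : C) : ¬ D.Oriented ε c → Glue ε (D.outL c) (D.outR c)

/-- The circles of the resolution `ε`: the classes of arcs under the equivalence relation that
gluing generates. -/
def Circle (ε : Finset C) : Type := Quot (D.Glue ε)

/-- The circle of the resolution `ε` that contains the arc `a`. -/
def circle (ε : Finset C) (a : A) : D.Circle ε := Quot.mk _ a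

instance [Finite A] (ε : Finset C) : Finite (D.Circle ε) :=
  Finite.of_surjective (D.circle ε) Quot.mk_surjective

/-- The basis of `V^{⊗ circles}`: a choice of `1` or `X` for each circle of the resolution `ε`. -/
abbrev Labeling (ε : Finset C) : Type := D.Circle ε → Gen

instance [Finite A] (ε : Finset C) : Fintype (D.Labeling ε) := Fintype.ofFinite _

/-- `M_ε`, the tensor product of one copy of `V` for each circle of the resolution `ε`, as the free
`ℤ`-module on the labelings of the circles (with `A` finite, these are finitely many, and
an element is the family of its coordinates). -/
abbrev M (ε : Finset C) : Type := D.Labeling ε → ℤ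

open scoped Classical in
/-- The matrix entry, from the labeling `l` of `ε` to the labeling `l'` of `ε'`, of the per-edge map
that changes the crossing `c` from its 0-resolution to its 1-resolution (`ε' = ε ∪ {c}`).
In either resolution of `c`, the arcs `inL c` and `outR c` lie on the two different strands near
`c`, so the circles through `c` are those of `inL c` and `outR c`. Circles that do not meet `c` keep
their label; if two circles merge into one the map is `m`, if one circle splits into two it is
`Δ`. For planar diagrams no other case occurs. -/
def edgeCoeff (c : C) (ε ε' : Finset C) (l : D.Labeling ε) (l' : D.Labeling ε') : ℤ :=
  let a := D.circle ε (D.inL c)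
  let b := D.circle ε (D.outR c)
  let a' := D.circle ε' (D.inL c)
  let b' := D.circle ε' (D.outR c)
  if ∀ x : A, D.circle ε x ≠ a → D.circle ε x ≠ b → l' (D.circle ε' x) = l (D.circle ε x) then
    if a ≠ b ∧ a' = b' then Gen.mulCoeff (l a) (l b) (l' a')
    else if a = b ∧ a' ≠ b' then Gen.comulCoeff (l a) (l' a') (l' b')
    else 0
  else 0

/-- The per-edge map `M_ε → M_ε'` at the crossing `c`. -/
def edgeMap [Finite A] (c : C) (ε ε' : Finset C) : D.M ε →ₗ[ℤ] D.M ε' where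
  toFun y := fun l' => ∑ l, D.edgeCoeff c ε ε' l l' * y l
  map_add' y z := by
    funext l'
    simp [mul_add, Finset.sum_add_distrib]
  map_smul' r y := by
    funext l'
    simp [Finset.mul_sum, mul_left_comm]

/-- The chain group `C^i(D) = ⨁_{|ε| = i} M_ε`, for `i ∈ ℤ` (zero if `i < 0` or if `i` exceeds the
number of crossings; for finite `C` the sum is finite, hence a product). -/
abbrev Chain (i : ℤ) : Type := (ε : {ε : Finset C // (ε.card : ℤ) = i}) → D.M ε.1

/-- The sign `(-1)^f` of the edge at `c` out of `ε`, where `f` is the number of 1-resolved crossings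
that come before `c` in the ordering `ord` of the crossings. -/
def edgeSign {n : ℕ} (ord : C ≃ Fin n) (c : C) (ε : Finset C) : ℤ :=
  (-1) ^ (ε.filter (fun c' => ord c' < ord c)).card

open scoped Classical in
/-- The differential: the signed sum of the per-edge maps. It is used for `j = i + 1`. -/
def d [Finite A] [Fintype C] {n : ℕ} (ord : C ≃ Fin n) (i j : ℤ) :
    D.Chain i →ₗ[ℤ] D.Chain j :=
  LinearMap.pi fun ε' =>
    ∑ ε : {ε : Finset C // (ε.card : ℤ) = i}, ∑ c : C,
      if c ∉ ε.1 ∧ ε'.1 = insert c ε.1 then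
        edgeSign ord c ε.1 • (D.edgeMap c ε.1 ε'.1 ∘ₗ LinearMap.proj ε)
      else 0

/-- The unnormalized homology group `H^i(D) = ker d^i / im d^{i-1}`. -/
abbrev unnormalizedHomology [Finite A] [Fintype C] {n : ℕ} (ord : C ≃ Fin n) (i : ℤ) : Type :=
  LinearMap.ker (D.d ord i (i + 1)) ⧸
    (LinearMap.range (D.d ord (i - 1) i)).submoduleOf (LinearMap.ker (D.d ord i (i + 1)))

/-- The number `n_-` of negative crossings. -/
def numNegative : ℕ := Nat.card {c : C // D.sign c = -1}

/-- The Khovanov homology group `ℋ^i(D) = H^{i + n_-}(D)` with integer coefficients (the direct sum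
over all quantum degrees), computed with the ordering `ord` of the crossings. -/
abbrev khovanovHomology [Finite A] [Fintype C] {n : ℕ} (ord : C ≃ Fin n) (i : ℤ) : Type :=
  D.unnormalizedHomology ord (i + D.numNegative)

end LinkDiagram

/-- A word in the generators `σ_1, …, σ_{p-1}` of the braid group on `p` strands and their inverses:
the `t`-th letter is `σ_{k+1}^{±1}` with `k = gen t` and exponent `sign t`. -/
structure BraidWord (p : ℕ) where
  length : ℕ
  gen : Fin length → Fin (p - 1)
  sign : Fin length → ℤˣ

namespace BraidWord

variable {p : ℕ} (β : BraidWord p)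

/-- A positive braid word: no inverses of generators occur. -/
def IsPositive : Prop := ∀ t, β.sign t = 1

/-- The position of the left strand of the `t`-th crossing. -/
def leftPos (t : Fin β.length) : Fin p := ⟨β.gen t, by have := (β.gen t).2; omega⟩

/-- The position of the right strand of the `t`-th crossing. -/
def rightPos (t : Fin β.length) : Fin p := ⟨β.gen t + 1, by have := (β.gen t).2; omega⟩

/-- The marked points of the closure: for each letter `t` and each strand that does not take part in
the `t`-th crossing one point, at the height of that crossing, and for each of the `p` positions one
point on the strand that closes up the braid. -/
abbrev Pt : Type :=
  {x : Fin β.length × Fin p // x.2 ≠ β.leftPos x.1 ∧ x.2 ≠ β.rightPos x.1} ⊕ Fin p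

/-- The diagram of the closure of a braid word. The strands run upwards, and the arc `(h, s)` is
the piece in position `s` between the `(h-1)`-th and the `h`-th letter (counted from `0`); the
arcs `(last, s)` at the top are joined to the arcs `(0, s)` at the bottom. -/
def closure : LinkDiagram (Fin β.length) (Fin (β.length + 1) × Fin p) β.Pt where
  sign := β.sign
  inL t := (t.castSucc, β.leftPos t)
  inR t := (t.castSucc, β.rightPos t)
  outL t := (t.succ, β.leftPos t)
  outR t := (t.succ, β.rightPos t)
  src := Sum.elim (fun x => (x.1.1.castSucc, x.1.2)) (fun s => (Fin.last _, s))
  dst := Sum.elim (fun x => (x.1.1.succ, x.1.2)) (fun s => (0, s))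
  ends := by
    have hne : ∀ t, β.leftPos t ≠ β.rightPos t := by
      intro t h
      simp [leftPos, rightPos] at h
    constructor
    · rintro ((t | t) | (⟨⟨t, s⟩, h1, h2⟩ | s)) ((t' | t') | (⟨⟨t', s'⟩, h1', h2'⟩ | s')) h <;>
        simp only [Sum.elim_inl, Sum.elim_inr, Prod.mk.injEq] at * <;>
        have := hne <;> grind [Fin.castSucc_inj, Fin.castSucc_lt_last]
    · rintro ⟨h, s⟩
      induction h using Fin.lastCases with
      | last => exact ⟨Sum.inr (Sum.inr s), rfl⟩
      | cast t =>
        by_cases h1 : s = β.leftPos t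
        · exact ⟨Sum.inl (Sum.inl t), by simp [h1]⟩
        · by_cases h2 : s = β.rightPos t
          · exact ⟨Sum.inl (Sum.inr t), by simp [h2]⟩
          · exact ⟨Sum.inr (Sum.inl ⟨(t, s), h1, h2⟩), rfl⟩
  starts := by
    have hne : ∀ t, β.leftPos t ≠ β.rightPos t := by
      intro t h
      simp [leftPos, rightPos] at h
    constructor
    · rintro ((t | t) | (⟨⟨t, s⟩, h1, h2⟩ | s)) ((t' | t') | (⟨⟨t', s'⟩, h1', h2'⟩ | s')) h <;>
        simp only [Sum.elim_inl, Sum.elim_inr, Prod.mk.injEq] at * <;>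
        have := hne <;> grind [Fin.succ_inj, Fin.succ_ne_zero]
    · rintro ⟨h, s⟩
      induction h using Fin.cases with
      | zero => exact ⟨Sum.inr (Sum.inr s), rfl⟩
      | succ t =>
        by_cases h1 : s = β.leftPos t
        · exact ⟨Sum.inl (Sum.inl t), by simp [h1]⟩
        · by_cases h2 : s = β.rightPos t
          · exact ⟨Sum.inl (Sum.inr t), by simp [h2]⟩
          · exact ⟨Sum.inr (Sum.inl ⟨(t, s), h1, h2⟩), rfl⟩

end BraidWord

end

noncomputable section

/-! For a positive braid the all-0 resolution respects the orientation, so its circles are the `p`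
strands and `C^0 = V^{⊗p}`. The 1-resolution of one crossing of `σ_k` merges strands `k` and `k+1`.
Hence a 1-cochain is a family `y_c`, with `y_c` in the quotient of `V^{⊗p}` by `X_k = X_{k+1}`,
where `k` is the generator of `c`, and `d^0` is the family of quotient maps.

Let `y` be a cocycle. Two crossings with the same generator give a merge followed by a split, and
the cocycle condition says that `y_c` and `y_{c'}` have the same image under `Δ`; as `Δ` is
injective, `y_c = y_{c'}` (`strandCoord_eq_of_gen_eq`). So `y` depends only on the generator. Two
crossings with different generators give two merges, and the condition says that the two elements
agree once both merges are made (`mergeOp_strandCoord_eq`).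

Such a compatible family lifts to a single element of `V^{⊗p}` (`exists_mergeOp_eq`): the generators
are treated from left to right, and each defect is lifted by labeling the new right strand `1`,
which leaves the earlier merges unchanged. The lift is a 0-cochain with coboundary `y`. -/

instance : DecidableEq Gen := Classical.decEq _

instance : Fintype Gen where
  elems := Insert.insert Gen.one (Singleton.singleton Gen.X)
  complete := by rintro (_ | _) <;> simp

theorem Gen.sum_univ (f : Gen → ℤ) : ∑ u, f u = f .one + f .X := by
  change ∑ u ∈ (Insert.insert Gen.one (Singleton.singleton Gen.X) : Finset Gen), f u = _
  rw [Finset.sum_pair (by simp)]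

/-! ### Multiplication of two tensor factors. -/

section Merge

variable {T : Type} [DecidableEq T]

/-- The multiplication `m` of the tensor factors `a` and `b`, on coordinate functions. The factor
`a` carries the product, and the result does not depend on the label of `b`. -/
def mergeOp (a b : T) (F : (T → Gen) → ℤ) (g : T → Gen) : ℤ :=
  ∑ u, ∑ v, Gen.mulCoeff u v (g a) * F (Function.update (Function.update g a u) b v)

theorem mergeOp_add (a b : T) (F G : (T → Gen) → ℤ) :
    mergeOp a b (F + G) = mergeOp a b F + mergeOp a b G := by
  funext g
  simp [mergeOp, mul_add, Finset.sum_add_distrib]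

theorem mergeOp_sub (a b : T) (F G : (T → Gen) → ℤ) :
    mergeOp a b (F - G) = mergeOp a b F - mergeOp a b G := by
  funext g
  simp [mergeOp, mul_sub, Finset.sum_sub_distrib]

theorem mergeOp_update_right {a b : T} (hab : a ≠ b) (F : (T → Gen) → ℤ) (g : T → Gen) (w : Gen) :
    mergeOp a b F (Function.update g b w) = mergeOp a b F g := by
  simp only [mergeOp]
  rw [Function.update_of_ne hab]
  refine Finset.sum_congr rfl fun u _ => Finset.sum_congr rfl fun v _ => ?_
  rw [Function.update_comm hab.symm, Function.update_idem]

/-- Products in disjoint pairs of tensor factors do not interact. -/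
theorem mergeOp_comm {a b c e : T} (hac : a ≠ c) (hae : a ≠ e) (hbc : b ≠ c) (hbe : b ≠ e)
    (F : (T → Gen) → ℤ) :
    mergeOp a b (mergeOp c e F) = mergeOp c e (mergeOp a b F) := by
  funext g
  have h : ∀ u v u' v', Function.update (Function.update (Function.update (Function.update g a u)
      b v) c u') e v' = Function.update (Function.update (Function.update (Function.update g c u')
      e v') a u) b v := by
    intro u v u' v'
    funext s
    simp only [Function.update_apply]
    grind
  simp only [mergeOp, Function.update_of_ne hac, Function.update_of_ne hae,
    Function.update_of_ne hbc.symm, Function.update_of_ne hac.symm, h, Gen.sum_univ]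
  ring

/-- Associativity of `m`: both sides collect the product of the factors `a`, `b`, `c` in position
`a`. -/
theorem mergeOp_assoc {a b c : T} (hac : a ≠ c) (hbc : b ≠ c)
    (F : (T → Gen) → ℤ) :
    mergeOp a c (mergeOp a b F) = mergeOp a b (mergeOp b c F) := by
  funext g
  have h : ∀ u v u' v', Function.update (Function.update (Function.update (Function.update g a u)
      c v) a u') b v' = Function.update (Function.update (Function.update g a u') b v') c v := by
    intro u v u' v'
    funext s
    simp only [Function.update_apply]
    grind
  have h' : ∀ u v u' v', Function.update (Function.update (Function.update (Function.update g a u)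
      b v) b u') c v' = Function.update (Function.update (Function.update g a u) b u') c v' := by
    intro u v u' v'
    simp
  simp only [mergeOp, h, h', Function.update_of_ne hac, Function.update_self, Gen.sum_univ]
  cases g a <;> simp [Gen.mulCoeff]
  ring

/-- A right inverse of `mergeOp a b`: the factor `b` gets the label `1`. -/
def liftOp (b : T) (F : (T → Gen) → ℤ) (g : T → Gen) : ℤ :=
  if g b = Gen.one then F g else 0

/-- This is the unit law for `1 ∈ V`; `hF` says that `F` comes from the tensor product without the
factor `b`. -/
theorem mergeOp_liftOp {a b : T} {F : (T → Gen) → ℤ}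
    (hF : ∀ g w, F (Function.update g b w) = F g) : mergeOp a b (liftOp b F) = F := by
  funext g
  have h : Function.update g a (g a) = g := Function.update_eq_self a g
  simp only [mergeOp, liftOp, Function.update_self, hF, Gen.sum_univ]
  rcases hg : g a <;> simp [Gen.mulCoeff] <;> rw [← hg, h]

theorem mergeOp_liftOp_of_ne {a b c : T} (hac : c ≠ a) (hbc : c ≠ b) (F : (T → Gen) → ℤ) :
    mergeOp a b (liftOp c F) = liftOp c (mergeOp a b F) := by
  funext g
  simp only [mergeOp, liftOp, Function.update_of_ne hac, Function.update_of_ne hbc]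
  split_ifs <;> simp

end Merge

/-! ### Lifting compatible families to `V^{⊗p}`. -/

section Strands

variable {p : ℕ}

/-- The left strand of the generator `σ_{k+1}`. -/
def leftStrand (k : Fin (p - 1)) : Fin p := ⟨k, by omega⟩

/-- The right strand of the generator `σ_{k+1}`. -/
def rightStrand (k : Fin (p - 1)) : Fin p := ⟨k + 1, by omega⟩

/-- The retraction of the strands that moves the right strand of a generator to the left one. -/
def joinStrands (k : Fin (p - 1)) (s : Fin p) : Fin p :=
  if s = rightStrand k then leftStrand k else s

theorem leftStrand_ne_rightStrand (k : Fin (p - 1)) : leftStrand k ≠ rightStrand k := by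
  simp [leftStrand, rightStrand]

/-- The lifting of compatible elements from the quotients of `V^{⊗p}` by the relations
`X_k = X_{k+1}` to `V^{⊗p}`. -/
theorem exists_mergeOp_eq (S : Set (Fin (p - 1))) (Y : Fin (p - 1) → (Fin p → Gen) → ℤ)
    (hY : ∀ k ∈ S, ∀ g w, Y k (Function.update g (rightStrand k) w) = Y k g)
    (hc : ∀ k ∈ S, ∀ l ∈ S, k < l →
      mergeOp (joinStrands k (leftStrand l)) (rightStrand l) (Y k) =
        mergeOp (leftStrand k) (rightStrand k) (Y l)) :
    ∃ R : (Fin p → Gen) → ℤ, ∀ k ∈ S, mergeOp (leftStrand k) (rightStrand k) R = Y k := by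
  suffices h : ∀ n : ℕ, ∃ R : (Fin p → Gen) → ℤ, ∀ k ∈ S, (k : ℕ) < n →
      mergeOp (leftStrand k) (rightStrand k) R = Y k by
    obtain ⟨R, hR⟩ := h p
    exact ⟨R, fun k hk => hR k hk (by omega)⟩
  intro n
  induction n with
  | zero => exact ⟨0, fun k _ h => absurd h (by omega)⟩
  | succ n ih =>
    obtain ⟨R, hR⟩ := ih
    by_cases hn : ∃ k ∈ S, (k : ℕ) = n
    · obtain ⟨k, hk, rfl⟩ := hn
      have hlr := leftStrand_ne_rightStrand k
      -- The defect of the current `R` at the new generator; adding its lift repairs the equation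
      -- for `k`.
      set Z := Y k - mergeOp (leftStrand k) (rightStrand k) R with hZ
      refine ⟨R + liftOp (rightStrand k) Z, fun j hj hjk => ?_⟩
      rw [mergeOp_add]
      rcases Nat.lt_succ_iff_lt_or_eq.mp hjk with hjk | hjk
      · have hjk' : j < k := hjk
        -- For `j < k` the right strand of `k` lies beyond both strands of `j`, so the merge at `j`
        -- passes through the lift and acts on the defect itself.
        rw [mergeOp_liftOp_of_ne (by simp [leftStrand, rightStrand]; omega)
          (by simp [rightStrand]; omega), hR j hj hjk]
        have h0 : mergeOp (leftStrand j) (rightStrand j) Z = 0 := by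
          rw [hZ, mergeOp_sub, ← hc j hj k hk hjk', ← hR j hj hjk, sub_eq_zero]
          -- Adjacent generators share a strand, and the two double merges agree by associativity;
          -- otherwise the pairs of strands are disjoint.
          by_cases hjk1 : (k : ℕ) = j + 1
          · have h1 : leftStrand k = rightStrand j := by
              simp [leftStrand, rightStrand, hjk1]
            rw [joinStrands, if_pos h1, h1]
            apply mergeOp_assoc <;> simp only [leftStrand, rightStrand, ne_eq, Fin.mk.injEq] <;>
              omega
          · rw [joinStrands, if_neg (by simp [leftStrand, rightStrand, hjk1])]
            apply mergeOp_comm <;> simp only [leftStrand, rightStrand, ne_eq, Fin.mk.injEq] <;>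
              omega
        rw [h0]
        funext g
        simp [liftOp]
      · obtain rfl : j = k := Fin.ext hjk
        rw [mergeOp_liftOp, hZ]
        · abel
        · intro g w
          simp [hZ, hY j hj, mergeOp_update_right hlr]
    · refine ⟨R, fun j hj hjn => hR j hj ?_⟩
      have : (j : ℕ) ≠ n := fun h => hn ⟨j, hj, h⟩
      omega

end Strands

/-! ### Circles indexed by a set of names, and the edge maps in these terms. -/

namespace LinkDiagram

variable {C A P T : Type} {D : LinkDiagram C A P} {ε ε' : Finset C}

/-- The fibres of `q` are the circles of the resolution `ε`. -/
def Classifies (D : LinkDiagram C A P) (ε : Finset C) (q : A → T) : Prop :=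
  ∀ x y, q x = q y ↔ D.circle ε x = D.circle ε y

namespace Classifies

variable {q q' : A → T} (h : D.Classifies ε q) (h' : D.Classifies ε' q')

/-- The labeling of the circles that a labeling of `T` induces. -/
def labeling (g : T → Gen) : D.Labeling ε :=
  Quot.lift (fun x => g (q x)) fun x y hxy => congrArg g ((h x y).2 (Quot.sound hxy))

theorem labeling_circle (g : T → Gen) (x : A) : h.labeling g (D.circle ε x) = g (q x) := rfl

theorem labeling_ext {l l' : D.Labeling ε} (H : ∀ x, l (D.circle ε x) = l' (D.circle ε x)) :
    l = l' := by
  funext z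
  induction z using Quot.inductionOn with
  | h x => exact H x

theorem labeling_congr {g g' : T → Gen} (H : ∀ x, g (q x) = g' (q x)) :
    h.labeling g = h.labeling g' :=
  labeling_ext H

theorem labeling_surjective : Function.Surjective h.labeling := by
  classical
  intro l
  -- Names outside the range of `q` belong to no circle; the label `1` there is arbitrary.
  refine ⟨fun t => if H : ∃ x, q x = t then l (D.circle ε H.choose) else Gen.one,
    labeling_ext fun x => ?_⟩
  have H : ∃ y, q y = q x := ⟨x, rfl⟩
  rw [labeling_circle, dif_pos H, (h _ _).1 H.choose_spec]

variable [Finite A] [DecidableEq T]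

/-- The merged circle keeps the name of the circle of `inL c`, and the name of the circle of `outR
c` falls out of use. Only labelings that agree with `g` off these two circles contribute, and they
are parametrized by the two free labels. -/
theorem edgeMap_merge (h : D.Classifies ε q) (h' : D.Classifies ε' q') (c : C)
    (hab : q (D.inL c) ≠ q (D.outR c)) (hb : q' (D.outR c) = q (D.inL c))
    (hq : ∀ x, q x ≠ q (D.outR c) → q' x = q x) (y : D.M ε) (g : T → Gen) :
    D.edgeMap c ε ε' y (h'.labeling g) =
      mergeOp (q (D.inL c)) (q (D.outR c)) (fun f => y (h.labeling f)) g := by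
  have ha : q' (D.inL c) = q (D.inL c) := hq _ hab
  have hab1 : D.circle ε (D.inL c) ≠ D.circle ε (D.outR c) := fun e => hab ((h _ _).2 e)
  have hab2 : D.circle ε' (D.inL c) = D.circle ε' (D.outR c) := (h' _ _).1 (ha.trans hb.symm)
  simp only [mergeOp, ← Fintype.sum_prod_type']
  refine (Fintype.sum_of_injective (fun uv : Gen × Gen => h.labeling (Function.update
    (Function.update g (q (D.inL c)) uv.1) (q (D.outR c)) uv.2)) ?_ _ _ ?_ ?_).symm
  · rintro ⟨u, v⟩ ⟨u', v'⟩ e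
    have e1 := congrFun e (D.circle ε (D.inL c))
    have e2 := congrFun e (D.circle ε (D.outR c))
    simp only [labeling_circle, Function.update_self, Function.update_of_ne hab] at e1 e2
    rw [e1, e2]
  · intro l hl
    rw [edgeCoeff, if_neg, zero_mul]
    intro H
    refine hl ⟨(l (D.circle ε (D.inL c)), l (D.circle ε (D.outR c))), labeling_ext fun x => ?_⟩
    simp only [labeling_circle, Function.update_apply]
    split_ifs with hx1 hx2
    · rw [(h _ _).1 hx1]
    · rw [(h _ _).1 hx2]
    · rw [← H x (fun e => hx2 ((h _ _).2 e)) (fun e => hx1 ((h _ _).2 e)), labeling_circle,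
        hq x hx1]
  · rintro ⟨u, v⟩
    rw [edgeCoeff, if_pos, if_pos ⟨hab1, hab2⟩]
    · simp only [labeling_circle, Function.update_self, Function.update_of_ne hab, ha]
    · intro x hx1 hx2
      have hx1' : q x ≠ q (D.inL c) := fun e => hx1 ((h _ _).1 e)
      have hx2' : q x ≠ q (D.outR c) := fun e => hx2 ((h _ _).1 e)
      simp only [labeling_circle, Function.update_of_ne hx1', Function.update_of_ne hx2',
        hq x hx2']

/-- The contributing labelings agree with `g` off the circle that splits, so the label `u` of that
circle is the only free parameter. -/
theorem edgeMap_split (h : D.Classifies ε q) (h' : D.Classifies ε' q') (c : C)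
    (hab : q (D.outR c) = q (D.inL c)) (hab' : q' (D.inL c) ≠ q' (D.outR c))
    (hq : ∀ x, q x ≠ q (D.inL c) → q' x = q x) (y : D.M ε) (g : T → Gen) :
    D.edgeMap c ε ε' y (h'.labeling g) =
      ∑ u, Gen.comulCoeff u (g (q' (D.inL c))) (g (q' (D.outR c))) *
        y (h.labeling (Function.update g (q (D.inL c)) u)) := by
  have hab1 : D.circle ε (D.inL c) = D.circle ε (D.outR c) := (h _ _).1 hab.symm
  have hab2 : D.circle ε' (D.inL c) ≠ D.circle ε' (D.outR c) := fun e => hab' ((h' _ _).2 e)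
  refine (Fintype.sum_of_injective (fun u : Gen => h.labeling
    (Function.update g (q (D.inL c)) u)) ?_ _ _ ?_ ?_).symm
  · intro u u' e
    simpa only [labeling_circle, Function.update_self] using congrFun e (D.circle ε (D.inL c))
  · intro l hl
    rw [edgeCoeff, if_neg, zero_mul]
    intro H
    refine hl ⟨l (D.circle ε (D.inL c)), labeling_ext fun x => ?_⟩
    simp only [labeling_circle, Function.update_apply]
    split_ifs with hx
    · rw [(h _ _).1 hx]
    · have hx' : D.circle ε x ≠ D.circle ε (D.inL c) := fun e => hx ((h _ _).2 e)
      rw [← H x hx' (hab1 ▸ hx'), labeling_circle, hq x hx]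
  · intro u
    rw [edgeCoeff, if_pos, if_neg (fun e => e.1 hab1), if_pos ⟨hab1, hab2⟩]
    · simp only [labeling_circle, Function.update_self]
    · intro x hx _
      have hx' : q x ≠ q (D.inL c) := fun e => hx ((h _ _).1 e)
      simp only [labeling_circle, Function.update_of_ne hx', hq x hx']

end Classifies

/-! ### The differentials around degree one. -/

section Differential

variable [Finite A] [Fintype C] {n : ℕ}

open scoped Classical in
/-- The differential out of degree zero. -/
theorem d_zero_apply (ord : C ≃ Fin n) {i j : ℤ} (r : D.Chain i) (c : C)
    (hi : ((∅ : Finset C).card : ℤ) = i) (hj : (({c} : Finset C).card : ℤ) = j) :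
    D.d ord i j r ⟨{c}, hj⟩ = D.edgeMap c ∅ {c} (r ⟨∅, hi⟩) := by
  simp only [d, LinearMap.pi_apply, LinearMap.sum_apply]
  rw [Fintype.sum_eq_single ⟨∅, hi⟩, Fintype.sum_eq_single c]
  · simp [edgeSign]
  · intro t ht
    rw [if_neg]
    · rfl
    · rintro ⟨-, h⟩
      simp only [insert_empty_eq, Finset.singleton_inj] at h
      exact ht h.symm
  · rintro ⟨ε, hε⟩ h
    refine absurd (Subtype.ext ?_) h
    rw [← hi] at hε
    simpa using hε

/-- The cocycle condition in degree one. -/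
theorem edgeMap_eq_of_d_eq_zero [inst : DecidableEq C] (ord : C ≃ Fin n) {i j : ℤ} (y : D.Chain i)
    (hy : D.d ord i j y = 0) {c c' : C} (hcc : c ≠ c')
    (hi : ∀ c : C, (({c} : Finset C).card : ℤ) = i)
    (hj : (({c, c'} : Finset C).card : ℤ) = j) :
    D.edgeMap c' {c} {c, c'} (y ⟨{c}, hi c⟩) = D.edgeMap c {c'} {c, c'} (y ⟨{c'}, hi c'⟩) := by
  obtain rfl : inst = fun a b => Classical.propDecidable (a = b) := Subsingleton.elim _ _
  classical
  have h := congrFun hy ⟨{c, c'}, hj⟩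
  simp only [d, LinearMap.pi_apply, LinearMap.sum_apply] at h
  rw [Fintype.sum_eq_add ⟨{c}, hi c⟩ ⟨{c'}, hi c'⟩ (by simpa using hcc),
    Fintype.sum_eq_single c', Fintype.sum_eq_single c, if_pos, if_pos] at h
  · simp only [LinearMap.smul_apply, LinearMap.comp_apply, LinearMap.proj_apply, edgeSign,
      Finset.filter_singleton, Pi.zero_apply] at h
    have hne : ord c ≠ ord c' := fun e => hcc (ord.injective e)
    -- In either order exactly one of the two edges into `{c, c'}` carries a minus sign.
    rcases lt_or_gt_of_ne hne with hlt | hlt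
    · rw [if_pos hlt, if_neg hlt.not_gt] at h
      simp at h
      exact (neg_add_eq_zero.mp h)
    · rw [if_pos hlt, if_neg hlt.not_gt] at h
      simp at h
      exact (add_neg_eq_zero.mp h)
  · exact ⟨by simpa using hcc, rfl⟩
  · exact ⟨by simpa using hcc.symm, Finset.pair_comm _ _⟩
  · intro t ht
    rw [if_neg]
    · rfl
    · rintro ⟨h1, h2⟩
      have : t ∈ ({c, c'} : Finset C) := h2 ▸ Finset.mem_insert_self _ _
      simp only [Finset.mem_insert, Finset.mem_singleton] at this h1
      tauto
  · intro t ht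
    rw [if_neg]
    · rfl
    · rintro ⟨h1, h2⟩
      have : t ∈ ({c, c'} : Finset C) := h2 ▸ Finset.mem_insert_self _ _
      simp only [Finset.mem_insert, Finset.mem_singleton] at this h1
      tauto
  · rintro ⟨ε, hε⟩ ⟨h1, h2⟩
    refine Finset.sum_eq_zero fun t _ => ?_
    rw [if_neg]
    · rfl
    · rintro ⟨h3, h4⟩
      have hε1 : ε.card = 1 := by
        have := hi c
        rw [Finset.card_singleton] at this
        omega
      obtain ⟨e, rfl⟩ := Finset.card_eq_one.mp hε1
      have : e ∈ ({c, c'} : Finset C) := h4 ▸ by simp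
      simp only [Finset.mem_insert, Finset.mem_singleton] at this
      rcases this with rfl | rfl
      · exact h1 rfl
      · exact h2 rfl

end Differential

end LinkDiagram

/-! ### Following a strand around the closure. -/

/-- A function on a cyclic sequence of heights that is constant except for jumps at `a` and `b`. -/
theorem Fin.eq_of_castSucc_eq_succ {m : ℕ} {X : Type} (f : Fin (m + 1) → X)
    (hf : f (Fin.last m) = f 0) {a b : Fin m} (hab : a ≤ b)
    (H : ∀ t, t ≠ a → t ≠ b → f t.castSucc = f t.succ) (h : Fin (m + 1)) :
    f h = if a < h.val ∧ h.val ≤ b then f a.succ else f 0 := by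
  have key : ∀ n (hn : n < m + 1), n ≤ m →
      f ⟨n, hn⟩ = if n ≤ a then f 0 else if n ≤ b then f a.succ else f b.succ := by
    intro n
    induction n with
    | zero => intro hn _; simp
    | succ n ih =>
      intro hn hm
      have ih := ih (by omega) (by omega)
      by_cases ha : n = a
      · have : (⟨n + 1, hn⟩ : Fin (m + 1)) = a.succ := Fin.ext (by simp [ha])
        rw [this, if_neg (by omega)]
        split_ifs with h1
        · rfl
        · have : a = b := Fin.ext (by have : a.val ≤ b.val := hab; omega)
          rw [this]
      by_cases hb : n = b
      · have : (⟨n + 1, hn⟩ : Fin (m + 1)) = b.succ := Fin.ext (by simp [hb])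
        have : a.val ≤ b.val := hab
        rw [if_neg (by omega), if_neg (by omega)]
        congr 1
      have hs := H ⟨n, by omega⟩ (fun e => ha (congrArg Fin.val e))
        (fun e => hb (congrArg Fin.val e))
      have hs' : f ⟨n + 1, hn⟩ = f ⟨n, by omega⟩ := hs.symm
      rw [hs', ih]
      congr 1
      · apply propext; omega
      · congr 1
        apply propext; omega
  -- Closing up the cycle identifies the stretch after `b` with the one before `a`.
  have hl := key m (by omega) le_rfl
  have hl' : f b.succ = f 0 := by
    rw [← hf, Fin.last, hl, if_neg (by omega), if_neg (by omega)]
  have hab' : a.val ≤ b.val := hab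
  obtain ⟨n, hn⟩ := h
  rw [key n hn (by omega), hl']
  dsimp only
  split_ifs <;> first | rfl | omega

/-- A single possible jump is no jump: the other way around the cycle avoids it. -/
theorem Fin.eq_zero_of_castSucc_eq_succ {m : ℕ} {X : Type} (f : Fin (m + 1) → X)
    (hf : f (Fin.last m) = f 0) (a : Fin m)
    (H : ∀ t, t ≠ a → f t.castSucc = f t.succ) (h : Fin (m + 1)) : f h = f 0 := by
  rw [Fin.eq_of_castSucc_eq_succ f hf (le_refl a) (fun t ht _ => H t ht), if_neg (by omega)]

theorem joinStrands_of_ne {p : ℕ} {k : Fin (p - 1)} {s : Fin p} (h : s ≠ rightStrand k) :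
    joinStrands k s = s := if_neg h

theorem joinStrands_right {p : ℕ} (k : Fin (p - 1)) :
    joinStrands k (rightStrand k) = leftStrand k := if_pos rfl

theorem joinStrands_left {p : ℕ} (k : Fin (p - 1)) :
    joinStrands k (leftStrand k) = leftStrand k :=
  joinStrands_of_ne (leftStrand_ne_rightStrand k)

/-! ### Circles of the resolutions with at most two 1-resolved crossings. -/

namespace BraidWord

variable {p : ℕ} {β : BraidWord p} {ε : Finset (Fin β.length)}

theorem circle_last (s : Fin p) :
    β.closure.circle ε (Fin.last _, s) = β.closure.circle ε (0, s) :=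
  Quot.sound (.point (Sum.inr s))

theorem circle_of_ne (t : Fin β.length) (s : Fin p) (h1 : s ≠ leftStrand (β.gen t))
    (h2 : s ≠ rightStrand (β.gen t)) :
    β.closure.circle ε (t.castSucc, s) = β.closure.circle ε (t.succ, s) :=
  Quot.sound (.point (Sum.inl ⟨(t, s), h1, h2⟩ : β.Pt))

theorem circle_of_notMem (hβ : β.IsPositive) (t : Fin β.length) (ht : t ∉ ε) (s : Fin p) :
    β.closure.circle ε (t.castSucc, s) = β.closure.circle ε (t.succ, s) := by
  have hor : β.closure.Oriented ε t := ⟨fun _ => ht, fun _ => hβ t⟩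
  by_cases h1 : s = leftStrand (β.gen t)
  · subst h1
    exact Quot.sound (.left t hor)
  by_cases h2 : s = rightStrand (β.gen t)
  · subst h2
    exact Quot.sound (.right t hor)
  exact circle_of_ne t s h1 h2

theorem not_oriented (hβ : β.IsPositive) {t : Fin β.length} (ht : t ∈ ε) :
    ¬ β.closure.Oriented ε t := fun h => (h.1 (hβ t)) ht

theorem circle_cap (hβ : β.IsPositive) {t : Fin β.length} (ht : t ∈ ε) :
    β.closure.circle ε (t.castSucc, leftStrand (β.gen t)) =
      β.closure.circle ε (t.castSucc, rightStrand (β.gen t)) :=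
  Quot.sound (.cap t (not_oriented hβ ht))

theorem circle_cup (hβ : β.IsPositive) {t : Fin β.length} (ht : t ∈ ε) :
    β.closure.circle ε (t.succ, leftStrand (β.gen t)) =
      β.closure.circle ε (t.succ, rightStrand (β.gen t)) :=
  Quot.sound (.cup t (not_oriented hβ ht))

/-- A map is constant on the circles of a resolution if it is unchanged when passing a letter on a
strand that goes through vertically, and at the top and at the bottom of each 1-resolved
crossing. -/
theorem eq_of_circle_eq (hβ : β.IsPositive) {T : Type} (q : Fin (β.length + 1) × Fin p → T)
    (hlast : ∀ s, q (Fin.last _, s) = q (0, s))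
    (hvert : ∀ t s, (t ∈ ε → s ≠ leftStrand (β.gen t) ∧ s ≠ rightStrand (β.gen t)) →
      q (t.castSucc, s) = q (t.succ, s))
    (hcap : ∀ t ∈ ε, q (t.castSucc, leftStrand (β.gen t)) =
      q (t.castSucc, rightStrand (β.gen t)))
    (hcup : ∀ t ∈ ε, q (t.succ, leftStrand (β.gen t)) = q (t.succ, rightStrand (β.gen t)))
    {x y} (hxy : β.closure.circle ε x = β.closure.circle ε y) : q x = q y := by
  have hg : ∀ x y, β.closure.Glue ε x y → q x = q y := by
    intro x y g
    cases g with
    | point z =>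
      rcases z with ⟨⟨t, s⟩, h⟩ | s
      · exact hvert t s fun _ => h
      · exact hlast s
    | left t h => exact hvert t _ fun h' => absurd h (not_oriented hβ h')
    | right t h => exact hvert t _ fun h' => absurd h (not_oriented hβ h')
    | cap t h =>
      refine hcap t ?_
      by_contra h'
      exact h ⟨fun _ => h', fun _ => hβ t⟩
    | cup t h =>
      refine hcup t ?_
      by_contra h'
      exact h ⟨fun _ => h', fun _ => hβ t⟩
  exact congrArg (Quot.lift q hg) hxy

/-- A map that is constant on the circles of a resolution classifies them if each arc lies on the
circle of an arc that depends only on the value of the map. -/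
theorem classifies_of_section {C A P T : Type} {D : LinkDiagram C A P} {ε : Finset C} {q : A → T}
    (h1 : ∀ x y, D.circle ε x = D.circle ε y → q x = q y) (σ : T → A)
    (h2 : ∀ x, D.circle ε x = D.circle ε (σ (q x))) : D.Classifies ε q :=
  fun x y => ⟨fun h => by rw [h2 x, h2 y, h], h1 x y⟩

theorem classifies_empty (hβ : β.IsPositive) :
    β.closure.Classifies ∅ (fun x : Fin (β.length + 1) × Fin p => x.2) := by
  refine classifies_of_section (fun x y => eq_of_circle_eq hβ (fun x => x.2) (fun _ => rfl)
    (fun _ _ _ => rfl)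
    (by simp) (by simp)) (fun s => (0, s)) ?_
  rintro ⟨h, s⟩
  -- Without letters there is only one height; otherwise any letter can serve as the exceptional
  -- one.
  rcases Nat.eq_zero_or_pos β.length with h0 | h0
  · have : h = 0 := Fin.ext (by simp; omega)
    rw [this]
  · exact Fin.eq_zero_of_castSucc_eq_succ (fun h => β.closure.circle ∅ (h, s)) (circle_last s)
      ⟨0, h0⟩ (fun t _ => circle_of_notMem hβ t (by simp) s) h

theorem classifies_singleton (hβ : β.IsPositive) (c : Fin β.length) :
    β.closure.Classifies {c}
      (fun x : Fin (β.length + 1) × Fin p => joinStrands (β.gen c) x.2) := by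
  have hs : ∀ h s, β.closure.circle {c} (h, s) = β.closure.circle {c} (0, s) := fun h s =>
    Fin.eq_zero_of_castSucc_eq_succ (fun h => β.closure.circle {c} (h, s)) (circle_last s)
      c (fun t ht => circle_of_notMem hβ t (by simpa using ht) s) h
  refine classifies_of_section (fun x y => eq_of_circle_eq hβ
    (fun x => joinStrands (β.gen c) x.2) (fun _ => rfl) (fun _ _ _ => rfl)
    (by simp [joinStrands_left, joinStrands_right])
    (by simp [joinStrands_left, joinStrands_right])) (fun s => (0, s)) ?_
  rintro ⟨h, s⟩
  rw [hs]
  by_cases hr : s = rightStrand (β.gen c)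
  · subst hr
    simp only [joinStrands_right]
    rw [← hs c.castSucc, ← hs c.castSucc, circle_cap hβ (Finset.mem_singleton_self c)]
  · simp only [joinStrands_of_ne hr]

/-- `joinStrands` for the larger generator acts first, so that for adjacent generators the rightmost
of the three strands is carried all the way to the leftmost. -/
theorem classifies_pair_of_lt (hβ : β.IsPositive) {c c' : Fin β.length}
    (hlt : β.gen c < β.gen c') (hε : ∀ t, t ∈ ε ↔ t = c ∨ t = c') :
    β.closure.Classifies ε (fun x : Fin (β.length + 1) × Fin p =>
      joinStrands (β.gen c) (joinStrands (β.gen c') x.2)) := by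
  have hlt' : (β.gen c).val < (β.gen c').val := hlt
  have hl1 : leftStrand (β.gen c) ≠ leftStrand (β.gen c') := by simp [leftStrand]; omega
  have hl2 : leftStrand (β.gen c) ≠ rightStrand (β.gen c') := by
    simp [leftStrand, rightStrand]; omega
  have hr2 : rightStrand (β.gen c) ≠ rightStrand (β.gen c') := by
    simp [rightStrand]; omega
  have hs' : ∀ s, (β.closure.circle ε (c.castSucc, s) = β.closure.circle ε (c.succ, s)) →
      ∀ h, β.closure.circle ε (h, s) = β.closure.circle ε (0, s) := by
    intro s hcs
    refine Fin.eq_zero_of_castSucc_eq_succ (fun h => β.closure.circle ε (h, s)) (circle_last s)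
      c' fun t ht => ?_
    by_cases htc : t = c
    · rw [htc]
      exact hcs
    · exact circle_of_notMem hβ t (by rw [hε]; tauto) s
  -- The left strand of the smaller generator does not take part in `c'`, so its only possible jump
  -- is at `c`.
  have hleft : ∀ h, β.closure.circle ε (h, leftStrand (β.gen c)) =
      β.closure.circle ε (0, leftStrand (β.gen c)) := by
    refine Fin.eq_zero_of_castSucc_eq_succ (fun h => β.closure.circle ε (h, leftStrand (β.gen c)))
      (circle_last _) c fun t ht => ?_
    by_cases htc : t = c'
    · rw [htc]
      exact circle_of_ne _ _ hl1 hl2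
    · exact circle_of_notMem hβ t (by rw [hε]; tauto) _
  have hc : c ∈ ε := (hε c).2 (Or.inl rfl)
  have hc' : c' ∈ ε := (hε c').2 (Or.inr rfl)
  have hs : ∀ s h, β.closure.circle ε (h, s) = β.closure.circle ε (0, s) := by
    intro s
    by_cases h1 : s = leftStrand (β.gen c)
    · rw [h1]
      exact hleft
    refine hs' s ?_
    by_cases h2 : s = rightStrand (β.gen c)
    -- Below and above `c` this strand is glued to the left strand, which stays on one circle; hence
    -- it has no jump at `c`.
    · rw [h2, ← circle_cap hβ hc, ← circle_cup hβ hc, hleft c.castSucc, hleft c.succ]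
    · exact circle_of_ne _ _ h1 h2
  have hj : ∀ t ∈ ε, joinStrands (β.gen c) (joinStrands (β.gen c') (leftStrand (β.gen t))) =
      joinStrands (β.gen c) (joinStrands (β.gen c') (rightStrand (β.gen t))) := by
    intro t ht
    rcases (hε t).1 ht with rfl | rfl
    · rw [joinStrands_of_ne hl2, joinStrands_of_ne hr2, joinStrands_left, joinStrands_right]
    · rw [joinStrands_left, joinStrands_right]
  have hright : ∀ t ∈ ε, ∀ s, β.closure.circle ε (0, s) =
      β.closure.circle ε (0, joinStrands (β.gen t) s) := by
    intro t ht s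
    by_cases hr : s = rightStrand (β.gen t)
    · rw [hr, joinStrands_right, ← hs _ t.castSucc, ← hs _ t.castSucc, circle_cap hβ ht]
    · rw [joinStrands_of_ne hr]
  refine classifies_of_section (fun x y => eq_of_circle_eq hβ
    (fun x => joinStrands (β.gen c) (joinStrands (β.gen c') x.2)) (fun _ => rfl) (fun _ _ _ => rfl)
    hj hj) (fun s => (0, s)) ?_
  rintro ⟨h, s⟩
  rw [hs, hright c' hc', hright c hc]

/-- The classifying map of the circles after the 1-resolution of two crossings `c < c'` of the same
generator: the right strand stands for the circle between the two crossings. -/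
def nestedCircle (β : BraidWord p) (c c' : Fin β.length) (x : Fin (β.length + 1) × Fin p) :
    Fin p :=
  if x.2 = leftStrand (β.gen c) ∨ x.2 = rightStrand (β.gen c) then
    if c < x.1.val ∧ x.1.val ≤ c' then rightStrand (β.gen c) else leftStrand (β.gen c)
  else x.2

/-- The pieces of the two strands between the crossings are closed off by the cup above `c` and the
cap below `c'`; the remaining pieces join through the closure. -/
theorem classifies_pair_of_eq (hβ : β.IsPositive) {c c' : Fin β.length} (hcc : c < c')
    (heq : β.gen c = β.gen c') (hε : ∀ t, t ∈ ε ↔ t = c ∨ t = c') :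
    β.closure.Classifies ε (β.nestedCircle c c') := by
  have hcc' : c.val < c'.val := hcc
  have hc : c ∈ ε := (hε c).2 (Or.inl rfl)
  have hs : ∀ s (h : Fin (β.length + 1)), β.closure.circle ε (h, s) =
      if c < h.val ∧ h.val ≤ c' then β.closure.circle ε (c.succ, s)
        else β.closure.circle ε (0, s) := fun s h =>
    Fin.eq_of_castSucc_eq_succ (fun h => β.closure.circle ε (h, s)) (circle_last s) hcc.le
      (fun t h1 h2 => circle_of_notMem hβ t (by rw [hε]; tauto) s) h
  have hgen : ∀ t ∈ ε, β.gen t = β.gen c := by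
    intro t ht
    rcases (hε t).1 ht with rfl | rfl
    · rfl
    · exact heq.symm
  have h0 : β.closure.circle ε (0, rightStrand (β.gen c)) =
      β.closure.circle ε (0, leftStrand (β.gen c)) := by
    have h := circle_cap hβ hc
    rw [hs, hs (rightStrand _), if_neg (by simp), if_neg (by simp)] at h
    exact h.symm
  refine classifies_of_section (fun x y => eq_of_circle_eq hβ (β.nestedCircle c c') ?_ ?_ ?_ ?_)
    (fun s => if s = rightStrand (β.gen c) then (c.succ, s) else (0, s)) ?_
  · intro s
    have : ¬ β.length ≤ c'.val := by omega
    simp [nestedCircle, this]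
  · intro t s h
    by_cases ht : t ∈ ε
    · have := h ht
      rw [hgen t ht] at this
      simp [nestedCircle, this]
    · have h1 : t.val ≠ c.val := fun e => ht ((hε t).2 (Or.inl (Fin.ext e)))
      have h2 : t.val ≠ c'.val := fun e => ht ((hε t).2 (Or.inr (Fin.ext e)))
      have : (c.val < t.val ∧ t.val ≤ c'.val) ↔ (c.val < t.val + 1 ∧ t.val + 1 ≤ c'.val) := by
        omega
      simp only [nestedCircle, Fin.val_castSucc, Fin.val_succ, this]
  · intro t ht
    simp [nestedCircle, hgen t ht]
  · intro t ht
    simp [nestedCircle, hgen t ht]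
  · rintro ⟨h, s⟩
    have hlr := leftStrand_ne_rightStrand (β.gen c)
    by_cases hlr' : s = leftStrand (β.gen c) ∨ s = rightStrand (β.gen c)
    · simp only [nestedCircle, if_pos hlr']
      by_cases hh : c.val < h.val ∧ h.val ≤ c'.val
      · simp only [if_pos hh, if_true]
        rw [hs s h, if_pos hh]
        rcases hlr' with rfl | rfl
        · exact circle_cup hβ hc
        · rfl
      · simp only [if_neg hh, if_neg hlr]
        rw [hs s h, if_neg hh]
        rcases hlr' with rfl | rfl
        · rfl
        · exact h0
    · simp only [nestedCircle, if_neg hlr', if_neg (fun e => hlr' (Or.inr e))]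
      rw [hs s h]
      split_ifs
      · rw [hs s c.succ, if_pos (by simp; omega)]
        have h1 := circle_of_ne (ε := ε) c s (fun e => hlr' (Or.inl e)) (fun e => hlr' (Or.inr e))
        rw [← h1, hs s c.castSucc, if_neg (by simp)]
      · rfl

end BraidWord

/-! ### The cocycle condition in strand coordinates, and the conclusion. -/

namespace BraidWord

variable {p : ℕ} {β : BraidWord p}

/-- A component of a chain of degree one as a function on the labelings of the strands. -/
def strandCoord (hβ : β.IsPositive) (c : Fin β.length) (z : β.closure.M {c}) (g : Fin p → Gen) :
    ℤ :=
  z ((classifies_singleton hβ c).labeling g)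

theorem strandCoord_update (hβ : β.IsPositive) (c : Fin β.length) (z : β.closure.M {c})
    (g : Fin p → Gen) (w : Gen) :
    strandCoord hβ c z (Function.update g (rightStrand (β.gen c)) w) = strandCoord hβ c z g := by
  refine congrArg z (LinkDiagram.Classifies.labeling_congr _ fun x => ?_)
  refine Function.update_of_ne ?_ _ _
  rw [joinStrands]
  split_ifs with h
  · exact leftStrand_ne_rightStrand _
  · exact h

theorem edgeMap_empty (hβ : β.IsPositive) (c : Fin β.length) (r : β.closure.M ∅)
    (g : Fin p → Gen) :
    strandCoord hβ c (β.closure.edgeMap c ∅ {c} r) g =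
      mergeOp (leftStrand (β.gen c)) (rightStrand (β.gen c))
        (fun f => r ((classifies_empty hβ).labeling f)) g :=
  LinkDiagram.Classifies.edgeMap_merge (classifies_empty hβ) (classifies_singleton hβ c) c
    (leftStrand_ne_rightStrand _) (joinStrands_right _) (fun _ hx => joinStrands_of_ne hx) r g

theorem strandCoord_eq_of_gen_eq (hβ : β.IsPositive) {c c' : Fin β.length} (hcc : c < c')
    (heq : β.gen c = β.gen c') (z : β.closure.M {c}) (z' : β.closure.M {c'})
    (hz : β.closure.edgeMap c' {c} {c, c'} z = β.closure.edgeMap c {c'} {c, c'} z') :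
    strandCoord hβ c z = strandCoord hβ c' z' := by
  have hlr := leftStrand_ne_rightStrand (β.gen c)
  have hcc' : c.val < c'.val := hcc
  have hP := classifies_pair_of_eq hβ hcc heq (ε := {c, c'}) (by simp)
  have hin : β.nestedCircle c c' (β.closure.inL c) = leftStrand (β.gen c) := by
    change β.nestedCircle c c' (c.castSucc, leftStrand (β.gen c)) = _
    simp [nestedCircle]
  have hout : β.nestedCircle c c' (β.closure.outR c) = rightStrand (β.gen c) := by
    change β.nestedCircle c c' (c.succ, rightStrand (β.gen c)) = _
    simp only [nestedCircle, Fin.val_succ]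
    rw [if_pos (Or.inr trivial), if_pos (by omega)]
  have hin' : β.nestedCircle c c' (β.closure.inL c') = rightStrand (β.gen c) := by
    change β.nestedCircle c c' (c'.castSucc, leftStrand (β.gen c')) = _
    simp [nestedCircle, ← heq, hcc]
  have hout' : β.nestedCircle c c' (β.closure.outR c') = leftStrand (β.gen c) := by
    change β.nestedCircle c c' (c'.succ, rightStrand (β.gen c')) = _
    simp [nestedCircle, ← heq]
  have hq : ∀ x : Fin (β.length + 1) × Fin p, joinStrands (β.gen c) x.2 ≠ leftStrand (β.gen c) →
      β.nestedCircle c c' x = joinStrands (β.gen c) x.2 := by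
    intro x hx
    have h2 : x.2 ≠ rightStrand (β.gen c) := fun e => hx (by rw [e, joinStrands_right])
    rw [joinStrands_of_ne h2] at hx ⊢
    exact if_neg (by tauto)
  have hjl : joinStrands (β.gen c) (leftStrand (β.gen c')) = leftStrand (β.gen c) := by
    rw [← heq, joinStrands_left]
  have hjr : joinStrands (β.gen c) (rightStrand (β.gen c')) = leftStrand (β.gen c) := by
    rw [← heq, joinStrands_right]
  have hjl' : joinStrands (β.gen c') (leftStrand (β.gen c)) = leftStrand (β.gen c) := by
    rw [← heq, joinStrands_left]
  have hjr' : joinStrands (β.gen c') (rightStrand (β.gen c)) = leftStrand (β.gen c) := by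
    rw [← heq, joinStrands_right]
  have h1 : ∀ g, β.closure.edgeMap c' {c} {c, c'} z (hP.labeling g) =
      ∑ u, Gen.comulCoeff u (g (rightStrand (β.gen c))) (g (leftStrand (β.gen c))) *
        strandCoord hβ c z (Function.update g (leftStrand (β.gen c)) u) := by
    intro g
    rw [LinkDiagram.Classifies.edgeMap_split (classifies_singleton hβ c) hP c'
      (hjr.trans hjl.symm) (by rw [hin', hout']; exact hlr.symm)
      (fun x hx => hq x (hjl ▸ hx)) z g, hin', hout']
    exact Finset.sum_congr rfl fun u _ => by rw [strandCoord, ← hjl]; rfl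
  have h2 : ∀ g, β.closure.edgeMap c {c'} {c, c'} z' (hP.labeling g) =
      ∑ u, Gen.comulCoeff u (g (leftStrand (β.gen c))) (g (rightStrand (β.gen c))) *
        strandCoord hβ c' z' (Function.update g (leftStrand (β.gen c)) u) := by
    intro g
    rw [LinkDiagram.Classifies.edgeMap_split (classifies_singleton hβ c') hP c
      (hjr'.trans hjl'.symm) (by rw [hin, hout]; exact hlr)
      (fun x hx => by
        rw [← heq] at hx ⊢
        exact hq x (by rwa [← hjl, ← heq])) z' g, hin, hout]
    exact Finset.sum_congr rfl fun u _ => by rw [strandCoord, ← hjl']; rfl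
  funext g
  -- The label of the right strand is free, and `X` is the useful choice: the part of `Δ u` with `X`
  -- in one factor has `u` in the other, which makes `Δ` injective.
  rw [← strandCoord_update hβ c z g Gen.X, ← strandCoord_update hβ c' z' g Gen.X, ← heq]
  set f := Function.update g (rightStrand (β.gen c)) Gen.X with hf
  have hfr : f (rightStrand (β.gen c)) = Gen.X := by simp [hf]
  have h := (h1 f).symm.trans ((congrFun hz _).trans (h2 f))
  have hfl := Function.update_eq_self (leftStrand (β.gen c)) f
  rw [hfr, Gen.sum_univ, Gen.sum_univ] at h
  rcases hl : f (leftStrand (β.gen c)) <;> rw [hl] at h hfl <;>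
    simpa [Gen.comulCoeff, hfl] using h

/-- Both edges into `{c, c'}` are merges here. If the generators are adjacent, the left strand of
`c'` has already been absorbed into the left strand of `c`, hence the `joinStrands`. -/
theorem mergeOp_strandCoord_eq (hβ : β.IsPositive) {c c' : Fin β.length}
    (hlt : β.gen c < β.gen c') (z : β.closure.M {c}) (z' : β.closure.M {c'})
    (hz : β.closure.edgeMap c' {c} {c, c'} z = β.closure.edgeMap c {c'} {c, c'} z') :
    mergeOp (joinStrands (β.gen c) (leftStrand (β.gen c'))) (rightStrand (β.gen c'))
        (strandCoord hβ c z) =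
      mergeOp (leftStrand (β.gen c)) (rightStrand (β.gen c)) (strandCoord hβ c' z') := by
  have hlt' : (β.gen c).val < (β.gen c').val := hlt
  have hl2 : leftStrand (β.gen c) ≠ rightStrand (β.gen c') := by
    simp [leftStrand, rightStrand]; omega
  have hr2 : rightStrand (β.gen c) ≠ rightStrand (β.gen c') := by
    simp [rightStrand]; omega
  have hP := classifies_pair_of_lt hβ hlt (ε := {c, c'}) (by simp)
  have hjr : joinStrands (β.gen c) (rightStrand (β.gen c')) = rightStrand (β.gen c') :=
    joinStrands_of_ne hr2.symm
  have hjl' : joinStrands (β.gen c') (leftStrand (β.gen c)) = leftStrand (β.gen c) :=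
    joinStrands_of_ne hl2
  have hjr' : joinStrands (β.gen c') (rightStrand (β.gen c)) = rightStrand (β.gen c) :=
    joinStrands_of_ne hr2
  have hne : joinStrands (β.gen c) (leftStrand (β.gen c')) ≠ rightStrand (β.gen c') := by
    rw [joinStrands]
    split_ifs
    · exact hl2
    · exact leftStrand_ne_rightStrand _
  funext g
  have h1 := LinkDiagram.Classifies.edgeMap_merge (classifies_singleton hβ c) hP c'
    (hne.trans_eq hjr.symm) (congrArg (joinStrands (β.gen c)) (joinStrands_right _))
    (fun x hx => congrArg (joinStrands (β.gen c))
      (joinStrands_of_ne fun e => hx (congrArg (joinStrands (β.gen c)) e))) z g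
  have h2 := LinkDiagram.Classifies.edgeMap_merge (classifies_singleton hβ c') hP c
    (by
      change joinStrands (β.gen c') (leftStrand (β.gen c)) ≠
        joinStrands (β.gen c') (rightStrand (β.gen c))
      rw [hjl', hjr']
      exact leftStrand_ne_rightStrand _)
    (by
      change joinStrands (β.gen c) (joinStrands (β.gen c') (rightStrand (β.gen c))) =
        joinStrands (β.gen c') (leftStrand (β.gen c))
      rw [hjl', hjr', joinStrands_right])
    (fun x hx => joinStrands_of_ne fun e => hx (e.trans hjr'.symm)) z' g
  have h := h1.symm.trans ((congrFun hz _).trans h2)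
  change mergeOp (joinStrands (β.gen c) (leftStrand (β.gen c')))
    (joinStrands (β.gen c) (rightStrand (β.gen c'))) (strandCoord hβ c z) g =
    mergeOp (joinStrands (β.gen c') (leftStrand (β.gen c)))
      (joinStrands (β.gen c') (rightStrand (β.gen c))) (strandCoord hβ c' z') g at h
  rwa [hjr, hjl', hjr'] at h

theorem ker_d_le_range_d (hβ : β.IsPositive) {n : ℕ} (ord : Fin β.length ≃ Fin n) {i : ℤ}
    (hi : i = 1) :
    LinearMap.ker (β.closure.d ord i (i + 1)) ≤ LinearMap.range (β.closure.d ord (i - 1) i) := by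
  classical
  intro y hy
  rw [LinearMap.mem_ker] at hy
  have h0 : ((∅ : Finset (Fin β.length)).card : ℤ) = i - 1 := by simp [hi]
  have h1 : ∀ c : Fin β.length, (({c} : Finset (Fin β.length)).card : ℤ) = i := by simp [hi]
  have hd : ∀ c c' : Fin β.length, c ≠ c' →
      β.closure.edgeMap c' {c} {c, c'} (y ⟨{c}, h1 c⟩) =
        β.closure.edgeMap c {c'} {c, c'} (y ⟨{c'}, h1 c'⟩) := fun c c' hcc =>
    LinkDiagram.edgeMap_eq_of_d_eq_zero ord y hy hcc h1 (by rw [Finset.card_pair hcc, hi]; rfl)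
  let Yc (c : Fin β.length) : (Fin p → Gen) → ℤ := strandCoord hβ c (y ⟨{c}, h1 c⟩)
  have hYc : ∀ c c', β.gen c = β.gen c' → Yc c = Yc c' := by
    intro c c' heq
    rcases lt_trichotomy c c' with hlt | rfl | hlt
    · exact strandCoord_eq_of_gen_eq hβ hlt heq _ _ (hd c c' hlt.ne)
    · rfl
    · exact (strandCoord_eq_of_gen_eq hβ hlt heq.symm _ _ (hd c' c hlt.ne)).symm
  -- The choice of a crossing is harmless by `hYc`; the value `0` at generators absent from the word
  -- is never used.
  let Y (k : Fin (p - 1)) : (Fin p → Gen) → ℤ :=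
    if H : ∃ c, β.gen c = k then Yc H.choose else 0
  have hY : ∀ c, Y (β.gen c) = Yc c := by
    intro c
    have H : ∃ c', β.gen c' = β.gen c := ⟨c, rfl⟩
    simp only [Y, dif_pos H]
    exact hYc _ _ H.choose_spec
  obtain ⟨R, hR⟩ := exists_mergeOp_eq (Set.range β.gen) Y
    (by
      rintro _ ⟨c, rfl⟩ g w
      rw [hY]
      exact strandCoord_update hβ c _ g w)
    (by
      rintro _ ⟨c, rfl⟩ _ ⟨c', rfl⟩ hlt
      rw [hY, hY]
      exact mergeOp_strandCoord_eq hβ hlt _ _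
        (hd c c' fun e => hlt.ne (congrArg β.gen e)))
  -- In degree `i - 1 = 0` only `ε = ∅` occurs, where the arcs at height `0` represent the circles;
  -- on the labeling induced by `f` this is `R f` by definition.
  let r : β.closure.Chain (i - 1) := fun ε l => R fun s => l (β.closure.circle ε.1 (0, s))
  refine ⟨r, ?_⟩
  funext ⟨ε, hε⟩
  obtain ⟨c, rfl⟩ : ∃ c, ε = {c} := Finset.card_eq_one.mp (by omega)
  rw [LinkDiagram.d_zero_apply ord r c h0]
  funext l
  obtain ⟨g, rfl⟩ := (classifies_singleton hβ c).labeling_surjective l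
  have h2 := edgeMap_empty hβ c (r ⟨∅, h0⟩) g
  exact h2.trans (congrFun ((hR _ ⟨c, rfl⟩).trans (hY c)) g)

theorem closure_numNegative (hβ : β.IsPositive) : β.closure.numNegative = 0 := by
  have : IsEmpty {c : Fin β.length // β.closure.sign c = -1} := by
    refine ⟨fun c => ?_⟩
    have h : (1 : ℤˣ) = -1 := (hβ c.1).symm.trans c.2
    exact absurd h (by decide)
  exact Nat.card_of_isEmpty

end BraidWord

theorem theorem2 (p : ℕ) (β : BraidWord p) (hβ : β.IsPositive)
    (ord : Fin β.length ≃ Fin β.length) :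
    Subsingleton (β.closure.khovanovHomology ord 1) := by
  have hi : (1 : ℤ) + (β.closure.numNegative : ℤ) = 1 := by
    rw [BraidWord.closure_numNegative hβ]
    rfl
  rw [LinkDiagram.khovanovHomology, LinkDiagram.unnormalizedHomology,
    Submodule.Quotient.subsingleton_iff, eq_top_iff]
  rintro ⟨y, hy⟩ -
  exact BraidWord.ker_d_le_range_d hβ ord hi hy

end
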